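/- A space $Y$ is homogeneous if for all $x,y\in Y$ there is a homeomorphism $h:Y\to Y$ with $h(x)=y$; a space $X$ is power homogeneous if $X^\kappa$ (with the product topology) is homogeneous for some cardinal $\kappa\ge 1$. A space $Y$ is countably tight if $t(Y)\le\omega$, i.e. whenever $A\subseteq Y$ and $x\in\overline{A}$, there is a countable $B\subseteq A$ with $x\in\overline{B}$. The $G_\delta$-modification $X_\delta$ of $X$ is the set $X$ with the topology generated by the $G_\delta$-sets of $X$. The Lindelöf number $L(Y)$ is the least infinite cardinal $\kappa$ such that every open cover of $Y$ has a subcover of cardinality at most $\kappa$. **Theorem.** Let $X$ be a power homogeneous compact Hausdorff space which is the union of a countable family of subspaces, each of which is dense in $X$ and countably tight (in its subspace topology). Then $L(X_\delta)\le\mathfrak{c}$, where $\mathfrak{c}=2^{\aleph_0}$. -/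

import Mathlib

open Cardinal

universe u v

/-- A space is homogeneous if any point can be moved to any other by a self-homeomorphism. -/
def IsHomogeneousSpace (X : Type u) [TopologicalSpace X] : Prop :=
  ∀ x y : X, ∃ h : X ≃ₜ X, h x = y

/-- A space `X` is power homogeneous if some power `X ^ κ`, with the product topology and a
nonzero cardinal `κ` (given here as the size of a nonempty index type `ι`), is homogeneous. -/
def IsPowerHomogeneous (X : Type u) [TopologicalSpace X] : Prop :=
  ∃ ι : Type v, Nonempty ι ∧ IsHomogeneousSpace (ι → X)

/-- `t(x, X)`: the least infinite cardinal `κ` such that whenever `x` is in the closure of `A`,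
it is in the closure of some `B ⊆ A` of cardinality at most `κ`. -/
noncomputable def tightnessAt {X : Type u} [TopologicalSpace X] (x : X) : Cardinal.{u} :=
  sInf {κ : Cardinal.{u} | ℵ₀ ≤ κ ∧
    ∀ A : Set X, x ∈ closure A → ∃ B : Set X, B ⊆ A ∧ #B ≤ κ ∧ x ∈ closure B}

/-- The tightness `t(X)`, the supremum of `t(x, X)` over all points `x` of `X`. -/
noncomputable def tightness (X : Type u) [TopologicalSpace X] : Cardinal.{u} :=
  ⨆ x : X, tightnessAt x

/-- A space is countably tight if its tightness is countable. -/
def IsCountablyTight (X : Type u) [TopologicalSpace X] : Prop :=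
  tightness X ≤ ℵ₀

/-- The Lindelöf number `L(X)`: the least infinite cardinal `κ` such that every open cover of `X`
has a subcover of cardinality at most `κ`. -/
noncomputable def lindelofNumber (X : Type u) [TopologicalSpace X] : Cardinal.{u} :=
  sInf {κ : Cardinal.{u} | ℵ₀ ≤ κ ∧
    ∀ 𝒰 : Set (Set X), (∀ U ∈ 𝒰, IsOpen U) → ⋃₀ 𝒰 = Set.univ →
      ∃ 𝒱 : Set (Set X), 𝒱 ⊆ 𝒰 ∧ #𝒱 ≤ κ ∧ ⋃₀ 𝒱 = Set.univ}

/-- The underlying set of the `G_δ`-modification `X_δ` of `X`, a copy of `X`. -/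
def GDeltaModification (X : Type u) : Type u := X

/-- The topology of `X_δ` is generated by the `G_δ`-sets of `X`. -/
instance GDeltaModification.instTopologicalSpace (X : Type u) [TopologicalSpace X] :
    TopologicalSpace (GDeltaModification X) :=
  TopologicalSpace.generateFrom {G : Set X | IsGδ G}

/-!
Write `𝔠` for the continuum, and call an intersection of at most `𝔠` open sets a `G_𝔠`-set. Let `X`
be compact Hausdorff, the union of countably many dense countably tight subspaces `C n`.

*Compactness argument.* If every point of `X` is a `G_𝔠`-point, then it has character at most `𝔠`,
so it lies in the closure of a subset of `C n` of size at most `𝔠`, for each `n`. A set `A` of size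
at most `𝔠` can then be closed off so that each `A ∩ C n` is dense in `A`. Countable tightness of the
`C n` makes `closure A` the union of the closures of the countable subsets of `A`, each of which has a
network of size `𝔠` and hence needs only `𝔠` members of a cover by `G_δ`-sets. Closing off `A`
further, compactness of `closure A` shows that the members used cover `X`
(`lindelofNumber_gDeltaModification_le`).

*Homogeneity.* It suffices that `G_𝔠`-points are dense (`IsPowerHomogeneous.isGc_singleton`). For
`g : (ι → X) → X` open and continuous, mapping a constant point `p` over a `G_𝔠`-point to `q`, take
`J ⊆ ι` of size at most `𝔠` such that, for all basic open sets `V` around `p` supported on finitely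
many coordinates in `J`, some `r ∈ V` has a `G_𝔠`-point as image that depends on coordinates in `J`
only. Then `g` is constant on the points that agree with `p` on `J`; by compactness `q` is a
`G_𝔠`-point.

*Density of `G_𝔠`-points.* Suppose that a closed `G_𝔠`-set has no `G_𝔠`-points. A set of size at
most `𝔠` has at most `𝔠` countable subsets, and their closures do not cover any nonempty `G_𝔠`-subset,
as otherwise the subset would have a network of size `𝔠`. So one can choose decreasing closed
`G_𝔠`-sets `H i`, for `i < 𝔠⁺`, that avoid the closures of the countable sets of points picked before
stage `i` (`exists_antitone_isGc`). This recursion is used twice. If the `H i` contain points of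
`π`-character at most `𝔠`, such points are limits of sets of size at most `𝔠` in each `C n`, and an
accumulation point of them contradicts countable tightness (`dense_setOf_isGc_singleton`). Such
points exist in every nonempty closed `G_𝔠`-set (`exists_hasPiCharacterLeContinuum`): if all points
of a compactum have `π`-character greater than `𝔠`, an irreducibility argument yields a closed
subspace of `π`-weight at most `𝔠⁺` without `G_𝔠`-points. There the recursion, applied to points
picked from a `π`-base, contradicts countable tightness again
(`exists_isGc_singleton_of_piBase`).
-/

/-! ### Sets of size at most the continuum -/

theorem mk_biUnion_le_continuum {ι : Type v} {α : Type u} {s : Set ι} (hs : #s ≤ 𝔠)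
    {f : ι → Set α} (hf : ∀ i ∈ s, #(f i) ≤ 𝔠) : #(⋃ i ∈ s, f i : Set α) ≤ 𝔠 := by
  have h := mk_biUnion_le_lift f s
  rw [← lift_le_continuum.{u, v}]
  refine h.trans ?_
  rw [← continuum_mul_self]
  refine mul_le_mul' (lift_le_continuum.2 hs) (ciSup_le' fun i => ?_)
  exact lift_le_continuum.2 (hf i i.2)

theorem mk_iUnion_le_continuum {ι : Type v} {α : Type u} (hι : #ι ≤ 𝔠) {f : ι → Set α}
    (hf : ∀ i, #(f i) ≤ 𝔠) : #(⋃ i, f i : Set α) ≤ 𝔠 := by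
  have := mk_biUnion_le_continuum (s := Set.univ) (f := f) (by rwa [mk_univ]) fun i _ => hf i
  rwa [Set.biUnion_univ] at this

theorem mk_union_le_continuum {α : Type u} {s t : Set α} (hs : #s ≤ 𝔠) (ht : #t ≤ 𝔠) :
    #(s ∪ t : Set α) ≤ 𝔠 :=
  (mk_union_le s t).trans ((add_le_add hs ht).trans_eq continuum_add_self)

theorem Set.Countable.mk_le_continuum {α : Type u} {s : Set α} (hs : s.Countable) : #s ≤ 𝔠 :=
  hs.le_aleph0.trans aleph0_le_continuum

theorem mk_image_le_continuum {ι : Type v} {α : Type u} {s : Set ι} (hs : #s ≤ 𝔠) (f : ι → α) :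
    #(f '' s : Set α) ≤ 𝔠 := by
  rw [← Set.biUnion_of_singleton (f '' s), Set.biUnion_image]
  exact mk_biUnion_le_continuum hs fun i _ => (Set.countable_singleton _).mk_le_continuum

theorem mk_range_le_continuum {ι : Type v} {α : Type u} (hι : #ι ≤ 𝔠) (f : ι → α) :
    #(Set.range f : Set α) ≤ 𝔠 := by
  rw [← Set.image_univ]
  exact mk_image_le_continuum (by rwa [mk_univ]) f

theorem mk_countable_subsets_le_continuum {α : Type u} {s : Set α} (hs : #s ≤ 𝔠) :
    #{t : Set α | t ⊆ s ∧ t.Countable} ≤ 𝔠 := by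
  have h := mk_bounded_subset_le s ℵ₀
  simp only [le_aleph0_iff_set_countable] at h
  refine h.trans ((power_le_power_right (max_le hs aleph0_le_continuum)).trans ?_)
  rw [continuum_power_aleph0]

theorem mk_finite_subsets_le_continuum {α : Type u} {s : Set α} (hs : #s ≤ 𝔠) :
    #{t : Set α | t ⊆ s ∧ t.Finite} ≤ 𝔠 :=
  (mk_le_mk_of_subset (t := {t : Set α | t ⊆ s ∧ t.Countable})
    fun _ ht => ⟨ht.1, ht.2.countable⟩).trans (mk_countable_subsets_le_continuum hs)

/-! ### Transfinite closing-off arguments -/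

theorem mk_Iio_succ_toType_le {κ : Cardinal.{u}} (i : (Order.succ κ).ord.ToType) :
    #(Set.Iio i) ≤ κ := by
  have h := mk_Iio_lt i (by simp)
  rwa [mk_toType, card_ord, Order.lt_succ_iff] at h

/-- In the initial ordinal of the successor of `κ`, sets of size at most `κ` are bounded. -/
theorem exists_forall_lt_of_mk_le {κ : Cardinal.{u}} (hκ : ℵ₀ ≤ κ)
    {s : Set (Order.succ κ).ord.ToType} (hs : #s ≤ κ) : ∃ i, ∀ j ∈ s, j < i := by
  by_contra! h
  have hcov : (⋃ j ∈ s, Set.Iic j) = Set.univ := by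
    refine Set.eq_univ_of_forall fun i => ?_
    obtain ⟨j, hj, hij⟩ := h i
    exact Set.mem_biUnion hj hij
  have h1 : #(⋃ j ∈ s, Set.Iic j : Set (Order.succ κ).ord.ToType) ≤ κ := by
    refine (mk_biUnion_le _ s).trans ?_
    refine (mul_le_mul' hs (ciSup_le' fun j => ?_)).trans_eq (mul_eq_self hκ)
    rw [← Set.Iio_insert]
    refine (mk_insert_le).trans ?_
    exact (add_le_add (mk_Iio_succ_toType_le j.1) (one_le_aleph0.trans hκ)).trans_eq (add_eq_self hκ)
  rw [hcov, mk_univ, mk_toType, card_ord] at h1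
  exact absurd h1 (Order.lt_succ κ).not_ge

instance nonempty_succ_toType {κ : Cardinal.{u}} : Nonempty (Order.succ κ).ord.ToType := by
  rw [← mk_ne_zero_iff, mk_toType, card_ord]
  exact (Order.succ_ne_bot κ)

theorem exists_subset_of_monotone {κ : Cardinal.{u}} (hκ : ℵ₀ ≤ κ) {α : Type u}
    {A : (Order.succ κ).ord.ToType → Set α} (hA : Monotone A) {s : Set α} (hs : #s ≤ κ)
    (hsA : s ⊆ ⋃ i, A i) : ∃ i, s ⊆ A i := by
  have h : ∀ x : s, ∃ i, x.1 ∈ A i := fun x => Set.mem_iUnion.1 (hsA x.2)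
  choose f hf using h
  obtain ⟨i, hi⟩ := exists_forall_lt_of_mk_le hκ (s := Set.range f) (mk_range_le.trans hs)
  exact ⟨i, fun x hx => hA (hi _ ⟨⟨x, hx⟩, rfl⟩).le (hf ⟨x, hx⟩)⟩

/-- Iterating an operation on sets of size at most `𝔠` along a well-order all of whose initial
segments have size at most `𝔠`. -/
theorem exists_chain_of_operation {I : Type v} [LinearOrder I] [WellFoundedLT I]
    (hI : ∀ i : I, #(Set.Iio i) ≤ 𝔠) {Y : Type u} {Φ : Set Y → Set Y}
    (hΦ : ∀ A : Set Y, #A ≤ 𝔠 → #(Φ A) ≤ 𝔠) :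
    ∃ A : I → Set Y, (∀ i, #(A i) ≤ 𝔠) ∧ ∀ i j, i < j → A i ∪ Φ (A i) ⊆ A j := by
  let A : I → Set Y := (wellFounded_lt (α := I)).fix
    fun i A => ⋃ j, ⋃ h : j < i, A j h ∪ Φ (A j h)
  have hA : ∀ i, A i = ⋃ j ∈ Set.Iio i, A j ∪ Φ (A j) := fun i => WellFounded.fix_eq _ _ i
  refine ⟨A, fun i => ?_, fun i j hij => ?_⟩
  · induction i using (wellFounded_lt (α := I)).induction with
    | _ i ih =>
      rw [hA]
      exact mk_biUnion_le_continuum (hI i) fun j hj => mk_union_le_continuum (ih j hj) (hΦ _ (ih j hj))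
  · rw [hA j]
    exact Set.subset_biUnion_of_mem (u := fun j => A j ∪ Φ (A j)) (Set.mem_Iio.2 hij)

/-- An operation sending countable sets to sets of size at most `𝔠` has a closed set of size at
most `𝔠`; the iteration has length `ω₁`. -/
theorem exists_closed_of_countable_operation {Y : Type u} {Φ : Set Y → Set Y}
    (hΦ : ∀ S : Set Y, S.Countable → #(Φ S) ≤ 𝔠) :
    ∃ T : Set Y, #T ≤ 𝔠 ∧ ∀ S ⊆ T, S.Countable → Φ S ⊆ T := by
  obtain ⟨A, hA, hAΦ⟩ := exists_chain_of_operation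
    (I := (Order.succ ℵ₀ : Cardinal.{u}).ord.ToType)
    (fun i => (mk_Iio_succ_toType_le i).trans aleph0_le_continuum)
    (Φ := fun A => ⋃ S ∈ {S : Set Y | S ⊆ A ∧ S.Countable}, Φ S)
    fun A hA => mk_biUnion_le_continuum (mk_countable_subsets_le_continuum hA)
      fun S hS => hΦ S hS.2
  have hmono : Monotone A := fun i j hij => by
    rcases hij.eq_or_lt with rfl | h
    · exact le_rfl
    · exact Set.subset_union_left.trans (hAΦ i j h)
  refine ⟨⋃ i, A i, mk_iUnion_le_continuum ?_ hA, fun S hST hS => ?_⟩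
  · rw [mk_toType, card_ord, Order.succ_le_iff]
    exact aleph0_lt_continuum
  · obtain ⟨i, hi⟩ := exists_subset_of_monotone le_rfl hmono hS.le_aleph0 hST
    obtain ⟨j, hj⟩ := exists_forall_lt_of_mk_le le_rfl (s := {i}) (by simp)
    intro x hx
    exact Set.mem_iUnion.2 ⟨j, hAΦ i j (hj i rfl) (Or.inr (Set.mem_biUnion (x := S) ⟨hi, hS⟩ hx))⟩

/-! ### Intersections of at most continuum many open sets -/

/-- A `G_𝔠`-set: an intersection of at most `𝔠` open sets. -/
def IsGc {X : Type u} [TopologicalSpace X] (s : Set X) : Prop :=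
  ∃ 𝒰 : Set (Set X), #𝒰 ≤ 𝔠 ∧ (∀ U ∈ 𝒰, IsOpen U) ∧ ⋂₀ 𝒰 = s

section Gc

variable {X : Type u} [TopologicalSpace X]

theorem IsGδ.isGc {s : Set X} (hs : IsGδ s) : IsGc s := by
  obtain ⟨T, hT, hc, rfl⟩ := hs
  exact ⟨T, hc.mk_le_continuum, hT, rfl⟩

theorem IsOpen.isGc {s : Set X} (hs : IsOpen s) : IsGc s := hs.isGδ.isGc

theorem isGc_biInter {ι : Type v} {s : Set ι} (hs : #s ≤ 𝔠) {f : ι → Set X}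
    (hf : ∀ i ∈ s, IsGc (f i)) : IsGc (⋂ i ∈ s, f i) := by
  choose! 𝒰 h𝒰 ho he using hf
  refine ⟨⋃ i ∈ s, 𝒰 i, mk_biUnion_le_continuum hs h𝒰, ?_, ?_⟩
  · simp only [Set.mem_iUnion, exists_prop]
    rintro U ⟨i, hi, hU⟩
    exact ho i hi U hU
  · rw [Set.sInter_iUnion]
    refine Set.iInter_congr fun i => ?_
    rw [Set.sInter_iUnion]
    exact Set.iInter_congr fun hi => he i hi

theorem IsGc.inter {s t : Set X} (hs : IsGc s) (ht : IsGc t) : IsGc (s ∩ t) := by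
  obtain ⟨𝒰, h𝒰, ho, rfl⟩ := hs
  obtain ⟨𝒱, h𝒱, ho', rfl⟩ := ht
  refine ⟨𝒰 ∪ 𝒱, mk_union_le_continuum h𝒰 h𝒱, ?_, Set.sInter_union 𝒰 𝒱⟩
  rintro U (hU | hU)
  exacts [ho U hU, ho' U hU]

theorem exists_isClosed_isGδ_mem_subset [NormalSpace X] [T1Space X] {U : Set X} (hU : IsOpen U)
    {x : X} (hx : x ∈ U) : ∃ Z, IsClosed Z ∧ IsGδ Z ∧ x ∈ Z ∧ Z ⊆ U := by
  obtain ⟨f, hf0, hf1, -⟩ := exists_continuous_zero_one_of_isClosed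
    (isClosed_singleton (x := x)) hU.isClosed_compl (by simpa using hx)
  refine ⟨f ⁻¹' {0}, isClosed_singleton.preimage f.continuous,
    isClosed_singleton.isGδ.preimage f.continuous, hf0 rfl, fun y hy => ?_⟩
  by_contra hyU
  have h1 : f y = 1 := hf1 hyU
  have h0 : f y = 0 := hy
  exact zero_ne_one (h0.symm.trans h1)

/-- In a compact Hausdorff space a closed `G_𝔠`-set has an outer base of size at most `𝔠`. -/
theorem IsGc.exists_outer_base [CompactSpace X] [T2Space X] {F : Set X} (hF : IsGc F)
    (hFc : IsClosed F) : ∃ 𝒪 : Set (Set X), #𝒪 ≤ 𝔠 ∧ (∀ O ∈ 𝒪, IsOpen O ∧ F ⊆ O) ∧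
      ∀ U, IsOpen U → F ⊆ U → ∃ O ∈ 𝒪, O ⊆ U := by
  obtain ⟨𝒰, h𝒰, ho, rfl⟩ := hF
  have h : ∀ U ∈ 𝒰, ∃ V, IsOpen V ∧ ⋂₀ 𝒰 ⊆ V ∧ closure V ⊆ U := fun U hU =>
    normal_exists_closure_subset hFc (ho U hU) (Set.sInter_subset_of_mem hU)
  choose! V hVo hFV hVU using h
  refine ⟨(fun 𝒲 => ⋂ U ∈ 𝒲, V U) '' {𝒲 | 𝒲 ⊆ 𝒰 ∧ 𝒲.Finite},
    mk_image_le_continuum (mk_finite_subsets_le_continuum h𝒰) _, ?_, fun U hU hFU => ?_⟩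
  · rintro _ ⟨𝒲, ⟨h𝒲, hfin⟩, rfl⟩
    exact ⟨hfin.isOpen_biInter fun U hU => hVo U (h𝒲 hU),
      Set.subset_iInter₂ fun U hU => hFV U (h𝒲 hU)⟩
  · obtain ⟨t, ht⟩ := hU.isClosed_compl.isCompact.elim_finite_subfamily_closed
      (fun U : 𝒰 => closure (V U)) (fun _ => isClosed_closure) (by
        rw [Set.eq_empty_iff_forall_notMem]
        rintro x ⟨hx, hx'⟩
        refine hx (hFU fun W hW => hVU W hW (Set.mem_iInter.1 hx' ⟨W, hW⟩)))
    refine ⟨_, ⟨Subtype.val '' (t : Set 𝒰), ⟨by simp, t.finite_toSet.image _⟩, rfl⟩, fun x hx => ?_⟩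
    by_contra hxU
    refine Set.eq_empty_iff_forall_notMem.1 ht x ⟨hxU, Set.mem_iInter₂.2 fun W hW => ?_⟩
    exact subset_closure (Set.mem_iInter₂.1 hx W.1 ⟨W, hW, rfl⟩)

/-- The closures of the subsets of `B` form a network for the closure of `B`. -/
theorem exists_subset_mem_closure_subset [RegularSpace X] {B U : Set X} {y : X}
    (hy : y ∈ closure B) (hU : U ∈ nhds y) : ∃ E ⊆ B, y ∈ closure E ∧ closure E ⊆ U := by
  obtain ⟨V, hV, hVc, hVU⟩ := exists_mem_nhds_isClosed_subset hU
  refine ⟨V ∩ B, Set.inter_subset_right, mem_closure_iff_nhds.2 fun t ht => ?_,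
    (closure_minimal Set.inter_subset_left hVc).trans hVU⟩
  rw [← Set.inter_assoc]
  exact mem_closure_iff_nhds.1 hy _ (Filter.inter_mem ht hV)

/-- If a `G_𝔠`-set is covered by the closures of the countable subsets of a set `S` of size at most
`𝔠`, then the closures of countable subsets of `S` form a network for it, so that each of its
points is a `G_𝔠`-point. -/
theorem IsGc.singleton_of_subset_closures [RegularSpace X] [T1Space X] {H S : Set X}
    (hH : IsGc H) (hS : #S ≤ 𝔠) (hHS : ∀ y ∈ H, ∃ B ⊆ S, B.Countable ∧ y ∈ closure B)
    {x : X} (hx : x ∈ H) : IsGc {x} := by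
  have hE : #{E : Set X | E ∈ {E : Set X | E ⊆ S ∧ E.Countable} ∧ x ∉ closure E} ≤ 𝔠 :=
    (mk_le_mk_of_subset fun E hE => hE.1).trans (mk_countable_subsets_le_continuum hS)
  have := hH.inter (isGc_biInter hE (f := fun E => (closure E)ᶜ)
    fun E _ => isClosed_closure.isOpen_compl.isGc)
  convert this using 1
  refine Set.Subset.antisymm ?_ ?_
  · rintro _ rfl
    exact ⟨hx, Set.mem_iInter₂.2 fun E hE => hE.2⟩
  · rintro y ⟨hyH, hy⟩
    by_contra hyx
    obtain ⟨B, hBS, hB, hyB⟩ := hHS y hyH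
    obtain ⟨E, hEB, hyE, hEx⟩ := exists_subset_mem_closure_subset hyB
      (isOpen_compl_singleton.mem_nhds hyx)
    exact Set.mem_iInter₂.1 hy E ⟨⟨hEB.trans hBS, hB.mono hEB⟩, fun hxE => hEx hxE rfl⟩ hyE

theorem exists_isGc_disjoint_closures [CompactSpace X] [T2Space X] {G S : Set X}
    (hGc : IsClosed G) (hG : IsGc G) (hne : G.Nonempty) (hno : ∀ x ∈ G, ¬ IsGc {x})
    (hS : #S ≤ 𝔠) : ∃ H ⊆ G, IsClosed H ∧ IsGc H ∧ H.Nonempty ∧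
      ∀ B ⊆ S, B.Countable → Disjoint H (closure B) := by
  obtain ⟨w, hwG, hw⟩ : ∃ w ∈ G, ∀ B ⊆ S, B.Countable → w ∉ closure B := by
    by_contra! h
    obtain ⟨x, hx⟩ := hne
    exact hno x hx (hG.singleton_of_subset_closures hS h hx)
  have hZ : ∀ B ∈ {B : Set X | B ⊆ S ∧ B.Countable}, ∃ Z, IsClosed Z ∧ IsGδ Z ∧ w ∈ Z ∧
      Z ⊆ (closure B)ᶜ := fun B hB =>
    exists_isClosed_isGδ_mem_subset isClosed_closure.isOpen_compl (hw B hB.1 hB.2)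
  choose! Z hZc hZδ hwZ hZB using hZ
  refine ⟨G ∩ ⋂ B ∈ {B : Set X | B ⊆ S ∧ B.Countable}, Z B, Set.inter_subset_left,
    hGc.inter (isClosed_biInter hZc), hG.inter (isGc_biInter
      (mk_countable_subsets_le_continuum hS) fun B hB => (hZδ B hB).isGc),
    ⟨w, hwG, Set.mem_iInter₂.2 hwZ⟩, fun B hBS hB => Set.disjoint_left.2 fun y hy => ?_⟩
  exact hZB B ⟨hBS, hB⟩ (Set.mem_iInter₂.1 hy.2 B ⟨hBS, hB⟩)

/-- Inside a closed `G_𝔠`-set without `G_𝔠`-points there are decreasing closed `G_𝔠`-sets `H i`,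
indexed by the initial ordinal of `𝔠⁺`, that eventually avoid the closure of each countable set of
points picked along the way. The points `Ψ i (H i)` picked at stage `i` may depend on `H i`. -/
theorem exists_antitone_isGc [CompactSpace X] [T2Space X] {H₀ : Set X}
    (hc : IsClosed H₀) (hG : IsGc H₀) (hne : H₀.Nonempty) (hno : ∀ x ∈ H₀, ¬ IsGc {x})
    {Ψ : (Order.succ (𝔠 : Cardinal.{u})).ord.ToType → Set X → Set X}
    (hΨ : ∀ i H, IsClosed H → IsGc H → H.Nonempty → H ⊆ H₀ → #(Ψ i H) ≤ 𝔠) :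
    ∃ H : (Order.succ (𝔠 : Cardinal.{u})).ord.ToType → Set X,
      (∀ i, IsClosed (H i) ∧ IsGc (H i) ∧ (H i).Nonempty ∧ H i ⊆ H₀) ∧ Antitone H ∧
      ∀ B ⊆ ⋃ i, Ψ i (H i), B.Countable → ∃ i, Disjoint (H i) (closure B) := by
  let I := (Order.succ (𝔠 : Cardinal.{u})).ord.ToType
  have hstep : ∀ G S : Set X, ∃ H, (IsClosed G ∧ IsGc G ∧ G.Nonempty ∧ G ⊆ H₀ ∧ #S ≤ 𝔠) →
      H ⊆ G ∧ IsClosed H ∧ IsGc H ∧ H.Nonempty ∧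
        ∀ B ⊆ S, B.Countable → Disjoint H (closure B) := fun G S => by
    by_cases h : IsClosed G ∧ IsGc G ∧ G.Nonempty ∧ G ⊆ H₀ ∧ #S ≤ 𝔠
    · obtain ⟨H, hH⟩ := exists_isGc_disjoint_closures h.1 h.2.1 h.2.2.1
        (fun x hx => hno x (h.2.2.2.1 hx)) h.2.2.2.2
      exact ⟨H, fun _ => hH⟩
    · exact ⟨∅, fun h' => absurd h' h⟩
  choose next hnext using hstep
  let H : I → Set X := (wellFounded_lt (α := I)).fix fun i H =>
    next (H₀ ∩ ⋂ j, ⋂ h : j < i, H j h) (⋃ j, ⋃ h : j < i, Ψ j (H j h))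
  have hH : ∀ i, H i = next (H₀ ∩ ⋂ j ∈ Set.Iio i, H j) (⋃ j ∈ Set.Iio i, Ψ j (H j)) :=
    fun i => WellFounded.fix_eq _ _ i
  have key : ∀ i, H i ⊆ H₀ ∩ ⋂ j ∈ Set.Iio i, H j ∧ IsClosed (H i) ∧ IsGc (H i) ∧ (H i).Nonempty ∧
      ∀ B ⊆ ⋃ j ∈ Set.Iio i, Ψ j (H j), B.Countable → Disjoint (H i) (closure B) := by
    intro i
    induction i using (wellFounded_lt (α := I)).induction with
    | _ i ih =>
      have hIio : #(Set.Iio i) ≤ 𝔠 := mk_Iio_succ_toType_le i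
      have hclosed : ∀ j ∈ Set.Iio i, IsClosed (H j) := fun j hj => (ih j hj).2.1
      have hn := hnext (H₀ ∩ ⋂ j ∈ Set.Iio i, H j) (⋃ j ∈ Set.Iio i, Ψ j (H j))
        ⟨hc.inter (isClosed_biInter hclosed),
          hG.inter (isGc_biInter hIio fun j hj => (ih j hj).2.2.1), ?_, Set.inter_subset_left,
          mk_biUnion_le_continuum hIio fun j hj => hΨ j _ (ih j hj).2.1 (ih j hj).2.2.1
            (ih j hj).2.2.2.1 ((ih j hj).1.trans Set.inter_subset_left)⟩
      · rw [← hH] at hn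
        exact hn
      · rcases isEmpty_or_nonempty (Set.Iio i) with hemp | hnon
        · have : (⋂ j ∈ Set.Iio i, H j) = Set.univ := by
            rw [Set.isEmpty_coe_sort.1 hemp, Set.biInter_empty]
          rwa [this, Set.inter_univ]
        · have hd : Directed (fun a b : Set X => a ⊇ b) fun j : Set.Iio i => H j := by
            refine directed_of_isDirected_le fun a b hab => ?_
            rcases hab.eq_or_lt with rfl | hlt
            · exact subset_rfl
            · exact (ih b b.2).1.trans (Set.inter_subset_right.trans
                (Set.biInter_subset_of_mem (Set.mem_Iio.2 hlt)))
          obtain ⟨x, hx⟩ := IsCompact.nonempty_iInter_of_directed_nonempty_isCompact_isClosed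
            (fun j : Set.Iio i => H j) hd (fun j => (ih j j.2).2.2.2.1)
            (fun j => (hclosed j j.2).isCompact) fun j => hclosed j j.2
          have hx' := Set.mem_iInter.1 hx
          exact ⟨x, ((ih _ hnon.some.2).1 (hx' hnon.some)).1,
            Set.mem_iInter₂.2 fun j hj => hx' ⟨j, hj⟩⟩
  have hanti : Antitone H := fun i j hij => by
    rcases hij.eq_or_lt with rfl | hlt
    · exact le_rfl
    · exact (key j).1.trans (Set.inter_subset_right.trans
        (Set.biInter_subset_of_mem (Set.mem_Iio.2 hlt)))
  refine ⟨H, fun i => ⟨(key i).2.1, (key i).2.2.1, (key i).2.2.2.1,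
    (key i).1.trans Set.inter_subset_left⟩, hanti, fun B hB hBc => ?_⟩
  obtain ⟨i, hi⟩ := exists_subset_of_monotone (aleph0_le_continuum)
    (A := fun i : I => ⋃ j ∈ Set.Iic i, Ψ j (H j))
    (fun i j hij => Set.biUnion_subset_biUnion_left (Set.Iic_subset_Iic.2 hij))
    hBc.mk_le_continuum (hB.trans (Set.iUnion_mono fun i =>
      Set.subset_biUnion_of_mem (u := fun j => Ψ j (H j)) Set.self_mem_Iic))
  obtain ⟨k, hk⟩ := exists_forall_lt_of_mk_le aleph0_le_continuum (s := {i})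
    (Set.countable_singleton i).mk_le_continuum
  refine ⟨k, (key k).2.2.2.2 B (hi.trans (Set.biUnion_subset_biUnion_left fun j hj => ?_)) hBc⟩
  exact lt_of_le_of_lt hj (hk i rfl)

end Gc

/-! ### Unions of countably many countably tight subspaces -/

section CountablyTight

variable {X : Type u} [TopologicalSpace X]

/-- Countable tightness of a subspace `C`, in terms of closures in the ambient space. -/
def CountablyTightIn (C : Set X) : Prop :=
  ∀ A ⊆ C, ∀ x ∈ C, x ∈ closure A → ∃ B ⊆ A, B.Countable ∧ x ∈ closure B

/-- The point `x` has a local `π`-base of size at most `𝔠`. -/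
def HasPiCharacterLeContinuum (x : X) : Prop :=
  ∃ 𝒱 : Set (Set X), #𝒱 ≤ 𝔠 ∧ (∀ V ∈ 𝒱, IsOpen V ∧ V.Nonempty) ∧
    ∀ U, IsOpen U → x ∈ U → ∃ V ∈ 𝒱, V ⊆ U

theorem IsCountablyTight.countablyTightIn {C : Set X} (hC : IsCountablyTight C) : CountablyTightIn C := by
  intro A hA x hx hxA
  have h1 : tightnessAt (⟨x, hx⟩ : C) ≤ ℵ₀ := (le_ciSup bddAbove_of_small _).trans hC
  have hne : {κ : Cardinal.{u} | ℵ₀ ≤ κ ∧ ∀ A : Set C, (⟨x, hx⟩ : C) ∈ closure A →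
      ∃ B : Set C, B ⊆ A ∧ #B ≤ κ ∧ (⟨x, hx⟩ : C) ∈ closure B}.Nonempty :=
    ⟨max ℵ₀ #C, le_max_left _ _, fun A hA => ⟨A, subset_rfl, (mk_set_le A).trans (le_max_right _ _), hA⟩⟩
  obtain ⟨-, h2⟩ := csInf_mem hne
  obtain ⟨B, hBA, hB, hxB⟩ := h2 (Subtype.val ⁻¹' A) (by
    rw [closure_subtype, Set.image_preimage_eq_of_subset (by simpa using hA)]
    exact hxA)
  refine ⟨Subtype.val '' B, by simpa using hBA, (le_aleph0_iff_set_countable.1 (hB.trans h1)).image _, ?_⟩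
  exact closure_subtype.1 hxB

theorem CountablyTightIn.preimage_val {C : Set X} (hC : CountablyTightIn C) (K : Set X) :
    CountablyTightIn (Subtype.val ⁻¹' C : Set K) := by
  intro A hA x hx hxA
  obtain ⟨B, hBA, hB, hxB⟩ := hC (Subtype.val '' A) (by simpa using hA) x hx
    (closure_subtype.1 hxA)
  obtain ⟨B, rfl⟩ : ∃ B' : Set K, Subtype.val '' B' = B :=
    ⟨Subtype.val ⁻¹' B, Set.image_preimage_eq_of_subset
      (hBA.trans (Set.image_subset_range _ _))⟩
  exact ⟨B, (Set.image_subset_image_iff Subtype.val_injective).1 hBA,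
    Set.countable_of_injective_of_countable_image Subtype.val_injective.injOn hB, closure_subtype.2 hxB⟩

/-- A nonempty σ-countably tight compactum of `π`-weight at most `𝔠⁺` has a `G_𝔠`-point. -/
theorem exists_isGc_singleton_of_piBase [CompactSpace X] [T2Space X] [Nonempty X]
    {C : ℕ → Set X} (hcov : ⋃ n, C n = Set.univ) (hC : ∀ n, CountablyTightIn (C n))
    {𝓑 : (Order.succ (𝔠 : Cardinal.{u})).ord.ToType → Set (Set X)} (h𝓑 : ∀ i, #(𝓑 i) ≤ 𝔠)
    (hopen : ∀ i, ∀ b ∈ 𝓑 i, IsOpen b)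
    (hbase : ∀ U : Set X, IsOpen U → U.Nonempty → ∃ i, ∃ b ∈ 𝓑 i, b.Nonempty ∧ b ⊆ U) :
    ∃ x : X, IsGc {x} := by
  by_contra! hno
  -- Points of the dense `G_δ`-set `⋂ n, T n` that belong to `C n` are interior to `closure (C n)`.
  let T : ℕ → Set X := fun n => interior (closure (C n)) ∪ (closure (C n))ᶜ
  have hTo : ∀ n, IsOpen (T n) := fun n =>
    isOpen_interior.union isClosed_closure.isOpen_compl
  have hTd : ∀ n, Dense (T n) := fun n => by
    have h := interior_frontier (isClosed_closure (s := C n))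
    rw [interior_eq_empty_iff_dense_compl] at h
    refine h.mono fun x hx => ?_
    rw [isClosed_closure.frontier_eq] at hx
    by_contra hxT
    simp only [T, Set.mem_union, Set.mem_compl_iff, not_or, not_not] at hxT
    exact hx ⟨hxT.2, hxT.1⟩
  obtain ⟨t, ht⟩ := (dense_iInter_of_isOpen hTo hTd).nonempty
  rw [Set.mem_iInter] at ht
  choose Z hZc hZδ htZ hZT using fun n => exists_isClosed_isGδ_mem_subset (hTo n) (ht n)
  have hp : ∀ (n : ℕ) (b : Set X), ∃ x, (b ∩ C n).Nonempty → x ∈ b ∩ C n := fun n b => by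
    by_cases h : (b ∩ C n).Nonempty
    · exact ⟨h.some, fun _ => h.some_mem⟩
    · exact ⟨t, fun h' => absurd h' h⟩
  choose p hp using hp
  let S : ℕ → (Order.succ (𝔠 : Cardinal.{u})).ord.ToType → Set X :=
    fun n i => p n '' {b ∈ 𝓑 i | (b ∩ C n).Nonempty}
  obtain ⟨H, hH, hanti, hHB⟩ := exists_antitone_isGc (H₀ := ⋂ n, Z n) (isClosed_iInter hZc)
    (IsGδ.iInter hZδ).isGc ⟨t, Set.mem_iInter.2 htZ⟩ (fun x _ => hno x)
    (Ψ := fun i _ => ⋃ n, S n i) fun i _ _ _ _ _ =>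
      mk_iUnion_le_continuum (mk_nat.trans_le aleph0_le_continuum) fun n =>
        mk_image_le_continuum ((mk_le_mk_of_subset (Set.sep_subset _ _)).trans (h𝓑 i)) _
  obtain ⟨y, hy⟩ := IsCompact.nonempty_iInter_of_directed_nonempty_isCompact_isClosed H
    hanti.directed_ge (fun i => (hH i).2.2.1) (fun i => (hH i).1.isCompact) fun i => (hH i).1
  rw [Set.mem_iInter] at hy
  obtain ⟨n, hyn⟩ := Set.mem_iUnion.1 (hcov ▸ Set.mem_univ y)
  have hyint : y ∈ interior (closure (C n)) := by
    have h1 := hZT n (Set.mem_iInter.1 ((hH (Classical.arbitrary _)).2.2.2 (hy _)) n)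
    exact h1.resolve_right fun h => h (subset_closure hyn)
  have hyS : y ∈ closure (⋃ i, S n i) := by
    refine mem_closure_iff.2 fun V hV hyV => ?_
    obtain ⟨i, b, hb, hbne, hbV⟩ := hbase _ (hV.inter isOpen_interior) ⟨y, hyV, hyint⟩
    have hbC : (b ∩ C n).Nonempty := by
      obtain ⟨z, hz⟩ := hbne
      exact mem_closure_iff.1 (interior_subset (hbV hz).2) b (hopen i b hb) hz
    exact ⟨p n b, (hbV (hp n b hbC).1).1, Set.mem_iUnion.2 ⟨i, b, ⟨hb, hbC⟩, rfl⟩⟩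
  obtain ⟨B, hBS, hB, hyB⟩ := hC n (⋃ i, S n i) (Set.iUnion_subset fun i => by
    rintro _ ⟨b, hb, rfl⟩
    exact (hp n b hb.2).2) y hyn hyS
  obtain ⟨i, hi⟩ := hHB B (hBS.trans (Set.iUnion_mono fun i =>
    Set.subset_iUnion (fun n => S n i) n)) hB
  exact Set.disjoint_left.1 hi (hy i) hyB

/-- If every point has `π`-character greater than `𝔠`, then a single finite open cover witnesses
this for a given family of at most `𝔠` open sets. -/
theorem exists_finite_cover_of_not_hasPiCharacter [CompactSpace X] [RegularSpace X]
    (hno : ∀ x : X, ¬ HasPiCharacterLeContinuum x) {𝒜 : Set (Set X)} (h𝒜 : #𝒜 ≤ 𝔠)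
    (hopen : ∀ b ∈ 𝒜, IsOpen b ∧ b.Nonempty) :
    ∃ 𝒲 : Set (Set X), 𝒲.Finite ∧ (∀ W ∈ 𝒲, IsOpen W) ∧ (∀ x, ∃ W ∈ 𝒲, x ∈ W) ∧
      ∀ W ∈ 𝒲, ∀ b ∈ 𝒜, ¬ b ⊆ closure W := by
  have h : ∀ x : X, ∃ W, IsOpen W ∧ x ∈ W ∧ ∀ b ∈ 𝒜, ¬ b ⊆ closure W := fun x => by
    have := hno x
    unfold HasPiCharacterLeContinuum at this
    push Not at this
    obtain ⟨U, hU, hxU, hUb⟩ := this 𝒜 h𝒜 hopen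
    obtain ⟨F, hF, hFc, hFU⟩ := exists_mem_nhds_isClosed_subset (hU.mem_nhds hxU)
    exact ⟨interior F, isOpen_interior, mem_interior_iff_mem_nhds.2 hF, fun b hb hbW =>
      hUb b hb (hbW.trans ((closure_minimal interior_subset hFc).trans hFU))⟩
  choose W hWo hxW hWb using h
  obtain ⟨t, ht⟩ := CompactSpace.elim_nhds_subcover W fun x => (hWo x).mem_nhds (hxW x)
  refine ⟨W '' t, t.finite_toSet.image _, ?_, fun x => ?_, ?_⟩
  · rintro _ ⟨x, -, rfl⟩
    exact hWo x
  · obtain ⟨z, hz, hxz⟩ := Set.mem_iUnion₂.1 (ht ▸ Set.mem_univ x : x ∈ ⋃ z ∈ t, W z)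
    exact ⟨W z, ⟨z, hz, rfl⟩, hxz⟩
  · rintro _ ⟨x, -, rfl⟩
    exact hWb x

/-- For a family `𝓑` of nonempty open sets that contains with each `b` a member whose closure lies
in `b`, a minimal closed set meeting the closures of all members has the traces of the members of
`𝓑` as a `π`-base. -/
theorem exists_closed_with_piBase [CompactSpace X] {𝓑 : Set (Set X)}
    (hne : ∀ b ∈ 𝓑, b.Nonempty) (hshrink : ∀ b ∈ 𝓑, ∃ b' ∈ 𝓑, closure b' ⊆ b) :
    ∃ K : Set X, IsClosed K ∧ (∀ b ∈ 𝓑, (K ∩ b).Nonempty) ∧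
      ∀ U : Set X, IsOpen U → (K ∩ U).Nonempty → ∃ b ∈ 𝓑, K ∩ b ⊆ U := by
  obtain ⟨K, -, hK⟩ := zorn_superset_nonempty
    {K : Set X | IsClosed K ∧ ∀ b ∈ 𝓑, (K ∩ closure b).Nonempty} (fun c hc hchain hcne => by
      refine ⟨⋂₀ c, ⟨isClosed_sInter fun F hF => (hc hF).1, fun b hb => ?_⟩,
        fun s hs => Set.sInter_subset_of_mem hs⟩
      have : Nonempty c := hcne.to_subtype
      have hd : Directed (fun a b : Set X => a ⊇ b) fun F : c => F.1 ∩ closure b := by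
        intro F G
        rcases hchain.total F.2 G.2 with h | h
        · exact ⟨F, subset_rfl, Set.inter_subset_inter_left _ h⟩
        · exact ⟨G, Set.inter_subset_inter_left _ h, subset_rfl⟩
      have hcl : ∀ F : c, IsClosed (F.1 ∩ closure b) := fun F => (hc F.2).1.inter isClosed_closure
      obtain ⟨x, hx⟩ := IsCompact.nonempty_iInter_of_directed_nonempty_isCompact_isClosed _ hd
        (fun F => (hc F.2).2 b hb) (fun F => (hcl F).isCompact) hcl
      rw [Set.mem_iInter] at hx
      exact ⟨x, fun F hF => (hx ⟨F, hF⟩).1, (hx this.some).2⟩)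
    Set.univ ⟨isClosed_univ, fun b hb => by simpa using hne b hb⟩
  have hmeet : ∀ b ∈ 𝓑, (K ∩ b).Nonempty := fun b hb => by
    obtain ⟨b', hb', hbb'⟩ := hshrink b hb
    exact (hK.prop.2 b' hb').mono (Set.inter_subset_inter_right _ hbb')
  refine ⟨K, hK.prop.1, hmeet, fun U hU hKU => ?_⟩
  by_contra! h
  obtain ⟨x, hxK, hxU⟩ := hKU
  refine (hK.le_of_le (y := K \ U) ⟨hK.prop.1.sdiff hU, fun b hb => ?_⟩ Set.sdiff_subset hxK).2 hxU
  obtain ⟨z, hz, hzU⟩ := Set.not_subset.1 (h b hb)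
  exact ⟨z, ⟨hz.1, hzU⟩, subset_closure hz.2⟩

/-- If all points had larger `π`-character, closing off a family of open sets under the finite covers
of `exists_finite_cover_of_not_hasPiCharacter` in `𝔠⁺` steps would give a nonempty closed subspace of
`π`-weight at most `𝔠⁺` without `G_𝔠`-points. -/
theorem exists_hasPiCharacterLeContinuum [CompactSpace X] [T2Space X] [Nonempty X]
    {C : ℕ → Set X} (hcov : ⋃ n, C n = Set.univ) (hC : ∀ n, CountablyTightIn (C n)) :
    ∃ x : X, HasPiCharacterLeContinuum x := by
  by_contra! hno
  let good : Set (Set X) := {b | IsOpen b ∧ b.Nonempty}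
  have hshrink : ∀ b ∈ good, ∃ b' ∈ good, closure b' ⊆ b := fun b ⟨hb, x, hx⟩ => by
    obtain ⟨F, hF, hFc, hFb⟩ := exists_mem_nhds_isClosed_subset (hb.mem_nhds hx)
    exact ⟨interior F, ⟨isOpen_interior, x, mem_interior_iff_mem_nhds.2 hF⟩,
      (closure_minimal interior_subset hFc).trans hFb⟩
  choose! s hsgood hs using hshrink
  have hcover : ∀ 𝒜 : Set (Set X), #𝒜 ≤ 𝔠 → ∃ 𝒲 : Set (Set X), 𝒲.Finite ∧
      (∀ W ∈ 𝒲, IsOpen W) ∧ (∀ x, ∃ W ∈ 𝒲, x ∈ W) ∧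
      ∀ W ∈ 𝒲, ∀ b ∈ 𝒜 ∩ good, ¬ b ⊆ closure W := fun 𝒜 h𝒜 =>
    exists_finite_cover_of_not_hasPiCharacter hno
      ((mk_le_mk_of_subset Set.inter_subset_left).trans h𝒜) fun b hb => hb.2
  choose! 𝒲 h𝒲fin h𝒲o h𝒲cov h𝒲 using hcover
  obtain ⟨A, hA, hAΦ⟩ := exists_chain_of_operation
    (I := (Order.succ (𝔠 : Cardinal.{u})).ord.ToType) mk_Iio_succ_toType_le
    (Φ := fun 𝒜 => {Set.univ} ∪ (s '' 𝒜 ∪ ⋃ W ∈ 𝒲 𝒜, (fun b => b \ closure W) '' 𝒜))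
    fun 𝒜 h𝒜 => mk_union_le_continuum (Set.countable_singleton _).mk_le_continuum <|
      mk_union_le_continuum (mk_image_le_continuum h𝒜 _) <|
        mk_biUnion_le_continuum (h𝒲fin 𝒜 h𝒜).countable.mk_le_continuum fun W _ =>
          mk_image_le_continuum h𝒜 _
  have hlt : ∀ i : (Order.succ (𝔠 : Cardinal.{u})).ord.ToType, ∃ j, i < j := fun i => by
    obtain ⟨j, hj⟩ := exists_forall_lt_of_mk_le aleph0_le_continuum (s := {i})
      (Set.countable_singleton i).mk_le_continuum
    exact ⟨j, hj i rfl⟩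
  have hmono : Monotone A := fun i j hij => by
    rcases hij.eq_or_lt with rfl | h
    · exact le_rfl
    · exact Set.subset_union_left.trans (hAΦ i j h)
  obtain ⟨K, hKc, hKmeet, hKbase⟩ := exists_closed_with_piBase (𝓑 := (⋃ i, A i) ∩ good)
    (fun b hb => hb.2.2) fun b hb => by
      obtain ⟨i, hi⟩ := Set.mem_iUnion.1 hb.1
      obtain ⟨j, hij⟩ := hlt i
      exact ⟨s b, ⟨Set.mem_iUnion.2 ⟨j, hAΦ i j hij (.inr (.inr (.inl ⟨b, hi, rfl⟩)))⟩,
        hsgood b hb.2⟩, hs b hb.2⟩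
  have : CompactSpace K := isCompact_iff_compactSpace.1 hKc.isCompact
  have : Nonempty K := by
    obtain ⟨j, hij⟩ := hlt (Classical.arbitrary _)
    obtain ⟨x, hx⟩ := hKmeet Set.univ ⟨Set.mem_iUnion.2 ⟨j, hAΦ _ j hij (.inr (.inl rfl))⟩,
      isOpen_univ, Set.univ_nonempty⟩
    exact ⟨⟨x, hx.1⟩⟩
  have hKbase' : ∀ U : Set K, IsOpen U → U.Nonempty →
      ∃ i, ∃ b ∈ A i ∩ good, (Subtype.val ⁻¹' b : Set K).Nonempty ∧ Subtype.val ⁻¹' b ⊆ U := by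
    rintro U hU ⟨x, hx⟩
    obtain ⟨U, hU', rfl⟩ := isOpen_induced_iff.1 hU
    obtain ⟨b, hb, hbU⟩ := hKbase U hU' ⟨x, x.2, hx⟩
    obtain ⟨i, hi⟩ := Set.mem_iUnion.1 hb.1
    obtain ⟨z, hz⟩ := hKmeet b hb
    exact ⟨i, b, ⟨hi, hb.2⟩, ⟨⟨z, hz.1⟩, hz.2⟩, fun z hz => hbU ⟨z.2, hz⟩⟩
  obtain ⟨x, hx⟩ := exists_isGc_singleton_of_piBase (X := K)
    (C := fun n => Subtype.val ⁻¹' C n) (by rw [← Set.preimage_iUnion, hcov, Set.preimage_univ])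
    (fun n => (hC n).preimage_val K)
    (𝓑 := fun i => (fun b => Subtype.val ⁻¹' b) '' (A i ∩ good))
    (fun i => mk_image_le_continuum ((mk_le_mk_of_subset Set.inter_subset_left).trans (hA i)) _)
    (by
      rintro i _ ⟨b, hb, rfl⟩
      exact hb.2.1.preimage continuous_subtype_val)
    (fun U hU hUne => by
      obtain ⟨i, b, hb, hbne, hbU⟩ := hKbase' U hU hUne
      exact ⟨i, _, ⟨b, hb, rfl⟩, hbne, hbU⟩)
  obtain ⟨𝒪, h𝒪, h𝒪o, h𝒪base⟩ := hx.exists_outer_base isClosed_singleton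
  have hb : ∀ O : 𝒪, ∃ i, ∃ b ∈ A i ∩ good, (Subtype.val ⁻¹' b : Set K) ⊆ O := fun O => by
    obtain ⟨i, b, hb, -, hbO⟩ := hKbase' O (h𝒪o O O.2).1 ⟨x, (h𝒪o O O.2).2 rfl⟩
    exact ⟨i, b, hb, hbO⟩
  -- The `π`-base of size `𝔠` at `x` obtained in this way appears at a stage `k`; the cover chosen
  -- for that stage defeats it.
  choose i b hb hbO using hb
  obtain ⟨k, hk⟩ := exists_forall_lt_of_mk_le aleph0_le_continuum (s := Set.range i)
    (mk_range_le_continuum h𝒪 _)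
  obtain ⟨W, hW, hxW⟩ := h𝒲cov (A k) (hA k) x
  obtain ⟨O, hO, hOW⟩ := h𝒪base (Subtype.val ⁻¹' W)
    ((h𝒲o (A k) (hA k) W hW).preimage continuous_subtype_val) (by simpa using hxW)
  have hbk : b ⟨O, hO⟩ ∈ A k ∩ good :=
    ⟨hmono (hk _ ⟨⟨O, hO⟩, rfl⟩).le (hb ⟨O, hO⟩).1, (hb ⟨O, hO⟩).2⟩
  obtain ⟨l, hkl⟩ := hlt k
  obtain ⟨z, hzK, hz⟩ := hKmeet (b ⟨O, hO⟩ \ closure W)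
    ⟨Set.mem_iUnion.2 ⟨l, hAΦ k l hkl
      (.inr (.inr (.inr (Set.mem_biUnion hW ⟨_, hbk.1, rfl⟩))))⟩,
      hbk.2.1.sdiff isClosed_closure, Set.sdiff_nonempty.2 (h𝒲 (A k) (hA k) W hW _ hbk)⟩
  exact hz.2 (subset_closure (hOW (hbO ⟨O, hO⟩ (show (⟨z, hzK⟩ : K) ∈ _ from hz.1))))

theorem HasPiCharacterLeContinuum.of_subtype [CompactSpace X] [T2Space X] {H : Set X}
    (hHc : IsClosed H) (hH : IsGc H) {w : H} (hw : HasPiCharacterLeContinuum w) :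
    HasPiCharacterLeContinuum (w : X) := by
  obtain ⟨𝒱, h𝒱, hne, hbase⟩ := hw
  have h : ∀ V ∈ 𝒱, ∃ F : Set X, IsClosed F ∧ IsGc F ∧ F.Nonempty ∧ F ⊆ Subtype.val '' V := by
    intro V hV
    obtain ⟨hVo, v, hv⟩ := hne V hV
    obtain ⟨V', hV', rfl⟩ := isOpen_induced_iff.1 hVo
    obtain ⟨Z, hZc, hZ, hvZ, hZV⟩ := exists_isClosed_isGδ_mem_subset hV' hv
    exact ⟨Z ∩ H, hZc.inter hHc, hZ.isGc.inter hH, ⟨v, hvZ, v.2⟩,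
      fun z hz => ⟨⟨z, hz.2⟩, hZV hz.1, rfl⟩⟩
  choose! F hFc hF hFne hFV using h
  have h𝒪 := fun V hV => (hF V hV).exists_outer_base (hFc V hV)
  choose! 𝒪 h𝒪card h𝒪o h𝒪base using h𝒪
  refine ⟨⋃ V ∈ 𝒱, 𝒪 V, mk_biUnion_le_continuum h𝒱 h𝒪card, fun O hO => ?_, fun U hU hwU => ?_⟩
  · obtain ⟨V, hV, hOV⟩ := Set.mem_iUnion₂.1 hO
    exact ⟨(h𝒪o V hV O hOV).1, (hFne V hV).mono (h𝒪o V hV O hOV).2⟩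
  · obtain ⟨V, hV, hVU⟩ := hbase (Subtype.val ⁻¹' U) (hU.preimage continuous_subtype_val) hwU
    obtain ⟨O, hO, hOU⟩ := h𝒪base V hV U hU ((hFV V hV).trans (Set.image_subset_iff.2 hVU))
    exact ⟨O, Set.mem_biUnion hV hO, hOU⟩

theorem HasPiCharacterLeContinuum.exists_subset_mem_closure {x : X}
    (hx : HasPiCharacterLeContinuum x) {C : Set X} (hC : Dense C) :
    ∃ A ⊆ C, #A ≤ 𝔠 ∧ x ∈ closure A := by
  obtain ⟨𝒱, h𝒱, hne, hbase⟩ := hx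
  have h : ∀ V ∈ 𝒱, ∃ y ∈ C, y ∈ V := fun V hV =>
    hC.exists_mem_open (hne V hV).1 (hne V hV).2
  have : Nonempty X := ⟨x⟩
  choose! p hpC hpV using h
  refine ⟨p '' 𝒱, by rintro _ ⟨V, hV, rfl⟩; exact hpC V hV, mk_image_le_continuum h𝒱 p,
    mem_closure_iff.2 fun U hU hxU => ?_⟩
  obtain ⟨V, hV, hVU⟩ := hbase U hU hxU
  exact ⟨p V, hVU (hpV V hV), V, hV, rfl⟩

/-- In an open set without `G_𝔠`-points, decreasing closed `G_𝔠`-sets `H i` with points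
`w (H i) ∈ H i` of `π`-character at most `𝔠` would accumulate at a point violating the countable
tightness of one of the dense subspaces. -/
theorem dense_setOf_isGc_singleton [CompactSpace X] [T2Space X] {C : ℕ → Set X}
    (hcov : ⋃ n, C n = Set.univ) (hC : ∀ n, CountablyTightIn (C n)) (hd : ∀ n, Dense (C n)) :
    Dense {x : X | IsGc {x}} := by
  rw [dense_iff_inter_open]
  rintro U hU ⟨t, ht⟩
  by_contra hno
  obtain ⟨H₀, hH₀c, hH₀, htH₀, hH₀U⟩ := exists_isClosed_isGδ_mem_subset hU ht
  have h : ∀ H : Set X, ∃ w, ∃ A : ℕ → Set X, IsClosed H → IsGc H → H.Nonempty →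
      w ∈ H ∧ ∀ n, A n ⊆ C n ∧ #(A n) ≤ 𝔠 ∧ w ∈ closure (A n) := by
    intro H
    by_cases hH : IsClosed H ∧ IsGc H ∧ H.Nonempty
    · obtain ⟨hHc, hH, hHne⟩ := hH
      have : CompactSpace H := isCompact_iff_compactSpace.1 hHc.isCompact
      have : Nonempty H := hHne.to_subtype
      obtain ⟨w, hw⟩ := exists_hasPiCharacterLeContinuum (X := H)
        (C := fun n => Subtype.val ⁻¹' C n)
        (by rw [← Set.preimage_iUnion, hcov, Set.preimage_univ])
        fun n => (hC n).preimage_val H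
      choose A hA using fun n => (hw.of_subtype hHc hH).exists_subset_mem_closure (hd n)
      exact ⟨w, A, fun _ _ _ => ⟨w.2, hA⟩⟩
    · exact ⟨t, fun _ => ∅, fun h1 h2 h3 => absurd ⟨h1, h2, h3⟩ hH⟩
  choose w A hwA using h
  obtain ⟨H, hH, hanti, hHB⟩ := exists_antitone_isGc hH₀c hH₀.isGc ⟨t, htH₀⟩
    (fun x hx hG => hno ⟨x, hH₀U hx, hG⟩) (Ψ := fun _ H => ⋃ n, A H n)
    fun _ H h1 h2 h3 _ => mk_iUnion_le_continuum (mk_nat.trans_le aleph0_le_continuum)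
      fun n => ((hwA H h1 h2 h3).2 n).2.1
  have hw := fun i => hwA (H i) (hH i).1 (hH i).2.1 (hH i).2.2.1
  obtain ⟨y, hy⟩ := IsCompact.nonempty_iInter_of_directed_nonempty_isCompact_isClosed
    (fun i => closure ((fun j => w (H j)) '' Set.Ici i))
    (Antitone.directed_ge fun i j hij => closure_mono (Set.image_mono (Set.Ici_subset_Ici.2 hij)))
    (fun i => ⟨w (H i), subset_closure ⟨i, Set.self_mem_Ici, rfl⟩⟩)
    (fun i => isClosed_closure.isCompact) fun i => isClosed_closure
  rw [Set.mem_iInter] at hy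
  have hyH : ∀ i, y ∈ H i := fun i => closure_minimal (by
    rintro _ ⟨j, hj, rfl⟩
    exact hanti hj (hw j).1) (hH i).1 (hy i)
  obtain ⟨n, hyn⟩ := Set.mem_iUnion.1 (hcov ▸ Set.mem_univ y)
  have hyA : y ∈ closure (⋃ i, A (H i) n) := closure_minimal (by
    rintro _ ⟨j, -, rfl⟩
    exact closure_mono (Set.subset_iUnion (fun i => A (H i) n) j) ((hw j).2 n).2.2)
    isClosed_closure (hy (Classical.arbitrary _))
  obtain ⟨B, hBA, hB, hyB⟩ := hC n _ (Set.iUnion_subset fun i => ((hw i).2 n).1) y hyn hyA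
  obtain ⟨i, hi⟩ := hHB B (hBA.trans (Set.iUnion_mono fun i =>
    Set.subset_iUnion (fun n => A (H i) n) n)) hB
  exact Set.disjoint_left.1 hi (hyH i) hyB

end CountablyTight

/-! ### Power homogeneity -/

section PowerHomogeneous

variable {X : Type u} [TopologicalSpace X]

theorem IsGc.preimage {Y : Type v} [TopologicalSpace Y] {f : Y → X} (hf : Continuous f) {s : Set X}
    (hs : IsGc s) : IsGc (f ⁻¹' s) := by
  obtain ⟨𝒰, h𝒰, ho, rfl⟩ := hs
  rw [Set.sInter_eq_biInter, Set.preimage_iInter₂]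
  exact isGc_biInter h𝒰 fun U hU => ((ho U hU).preimage hf).isGc

/-- A continuous map on a power depends, at a point over a `G_𝔠`-point, on at most `𝔠`
coordinates. -/
theorem exists_coordinates_of_isGc {ι : Type v} {g : (ι → X) → X} (hg : Continuous g) {r : ι → X}
    (hr : IsGc {g r}) : ∃ A : Set ι, #A ≤ 𝔠 ∧ ∀ r', (∀ i ∈ A, r' i = r i) → g r' = g r := by
  obtain ⟨𝒰, h𝒰, ho, he⟩ := hr
  have h : ∀ U ∈ 𝒰, ∃ F : Finset ι, ∀ r', (∀ i ∈ F, r' i = r i) → g r' ∈ U := by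
    intro U hU
    have hrU : g r ∈ U := Set.mem_sInter.1 (he.symm ▸ rfl : g r ∈ ⋂₀ 𝒰) U hU
    obtain ⟨F, u, hu, hFU⟩ := isOpen_pi_iff.1 ((ho U hU).preimage hg) r hrU
    exact ⟨F, fun r' hr' => hFU fun i hi => by rw [hr' i hi]; exact (hu i hi).2⟩
  choose! F hF using h
  refine ⟨⋃ U ∈ 𝒰, (F U : Set ι), mk_biUnion_le_continuum h𝒰 fun U _ =>
    (F U).countable_toSet.mk_le_continuum, fun r' hr' => ?_⟩
  have : g r' ∈ ⋂₀ 𝒰 := Set.mem_sInter.2 fun U hU => hF U hU r' fun i hi =>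
    hr' i (Set.mem_biUnion hU hi)
  rw [he] at this
  exact this

open Classical in
/-- Let `g` be the composite of a coordinate projection with a homeomorphism of a power that moves
a constant point at a `G_𝔠`-point `p` over `q`. If `G_𝔠`-points are dense, `g` is constant on the
set of points that agree with `p` on some set `J` of at most `𝔠` coordinates. -/
theorem IsPowerHomogeneous.isGc_singleton [CompactSpace X] [T2Space X]
    (hX : IsPowerHomogeneous.{u, v} X) (hd : Dense {x : X | IsGc {x}}) (q : X) : IsGc {q} := by
  obtain ⟨ι, ⟨i₀⟩, hhom⟩ := hX
  have : Nonempty X := ⟨q⟩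
  obtain ⟨p, hp⟩ := hd.nonempty
  obtain ⟨h, hpq⟩ := hhom (fun _ => p) fun _ => q
  let g : (ι → X) → X := fun z => h z i₀
  have hgc : Continuous g := (continuous_apply i₀).comp h.continuous
  have hgo : IsOpenMap g := (isOpenMap_eval i₀).comp h.isOpenMap
  have hgp : g (fun _ => p) = q := congrFun hpq i₀
  obtain ⟨𝒪, h𝒪, h𝒪o, h𝒪base⟩ := IsGc.exists_outer_base hp isClosed_singleton
  have hr : ∀ (R : Set ι) (W : Set X), ∃ (r : ι → X) (A : Set ι), #A ≤ 𝔠 ∧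
      (R.Finite → W ∈ 𝒪 → (∀ i ∈ R, r i ∈ W) ∧ ∀ r', (∀ i ∈ A, r' i = r i) → g r' = g r) := by
    intro R W
    by_cases hRW : R.Finite ∧ W ∈ 𝒪
    · obtain ⟨_, ⟨r, hrW, rfl⟩, hd'⟩ := hd.inter_open_nonempty _
        (hgo _ (isOpen_set_pi hRW.1 fun _ _ => (h𝒪o W hRW.2).1))
        ⟨_, Set.mem_image_of_mem g (fun _ _ => (h𝒪o W hRW.2).2 rfl : (fun _ => p) ∈ R.pi fun _ => W)⟩
      obtain ⟨A, hA, hrA⟩ := exists_coordinates_of_isGc hgc hd'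
      exact ⟨r, A, hA, fun _ _ => ⟨hrW, hrA⟩⟩
    · exact ⟨fun _ => p, ∅, by simp, fun h1 h2 => absurd ⟨h1, h2⟩ hRW⟩
  choose r A hA hrA using hr
  obtain ⟨J, hJ, hJΦ⟩ := exists_closed_of_countable_operation
    (Φ := fun R => ⋃ W ∈ 𝒪, A R W) fun R _ => mk_biUnion_le_continuum h𝒪 fun W _ => hA R W
  have hconst : ∀ y : ι → X, (∀ i ∈ J, y i = p) → g y = q := by
    intro y hy
    by_contra hne
    obtain ⟨O₁, O₂, hO₁, hO₂, hy₁, hq₂, hdisj⟩ := t2_separation hne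
    obtain ⟨F₁, u₁, hu₁, hF₁⟩ := isOpen_pi_iff.1 (hO₁.preimage hgc) y hy₁
    obtain ⟨F₂, u₂, hu₂, hF₂⟩ := isOpen_pi_iff.1 (hO₂.preimage hgc) (fun _ => p)
      (by rwa [Set.mem_preimage, hgp])
    obtain ⟨W, hW, hWu⟩ := h𝒪base
      ((⋂ i ∈ F₁.filter (· ∈ J), u₁ i) ∩ ⋂ i ∈ F₂, u₂ i)
      ((isOpen_biInter_finset fun i hi => (hu₁ i (Finset.mem_filter.1 hi).1).1).inter
        (isOpen_biInter_finset fun i hi => (hu₂ i hi).1))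
      (by
        rw [Set.singleton_subset_iff]
        refine ⟨Set.mem_iInter₂.2 fun i hi => ?_, Set.mem_iInter₂.2 fun i hi => (hu₂ i hi).2⟩
        rw [Finset.mem_filter] at hi
        rw [← hy i hi.2]
        exact (hu₁ i hi.1).2)
    let R : Set ι := {i | (i ∈ F₁ ∨ i ∈ F₂) ∧ i ∈ J}
    have hRfin : R.Finite := (F₁ ∪ F₂).finite_toSet.subset fun i hi => by simpa using hi.1
    obtain ⟨hrW, hrg⟩ := hrA R W hRfin hW
    have hAJ : A R W ⊆ J := (Set.subset_biUnion_of_mem (u := fun W => A R W) hW).trans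
      (hJΦ R (fun i hi => hi.2) hRfin.countable)
    -- Changing `r R W` outside `J` does not change its image, which therefore lies in both
    -- `O₁` and `O₂`.
    have h₁ : g (r R W) ∈ O₁ := by
      rw [← hrg (J.piecewise (r R W) y) fun i hi => Set.piecewise_eq_of_mem _ _ _ (hAJ hi)]
      refine hF₁ fun i hi => ?_
      by_cases hiJ : i ∈ J
      · rw [Set.piecewise_eq_of_mem _ _ _ hiJ]
        exact Set.mem_iInter₂.1 (hWu (hrW i ⟨.inl hi, hiJ⟩)).1 i (Finset.mem_filter.2 ⟨hi, hiJ⟩)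
      · rw [Set.piecewise_eq_of_notMem _ _ _ hiJ]
        exact (hu₁ i hi).2
    have h₂ : g (r R W) ∈ O₂ := by
      rw [← hrg (J.piecewise (r R W) fun _ => p) fun i hi =>
        Set.piecewise_eq_of_mem _ _ _ (hAJ hi)]
      refine hF₂ fun i hi => ?_
      by_cases hiJ : i ∈ J
      · rw [Set.piecewise_eq_of_mem _ _ _ hiJ]
        exact Set.mem_iInter₂.1 (hWu (hrW i ⟨.inr hi, hiJ⟩)).2 i hi
      · rw [Set.piecewise_eq_of_notMem _ _ _ hiJ]
        exact (hu₂ i hi).2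
    exact Set.disjoint_left.1 hdisj h₁ h₂
  have hZ : IsGc (⋂ i ∈ J, (fun z : ι → X => z i) ⁻¹' {p}) :=
    isGc_biInter hJ fun i _ => IsGc.preimage (continuous_apply i) hp
  obtain ⟨𝒱, h𝒱, h𝒱o, h𝒱base⟩ := hZ.exists_outer_base
    (isClosed_biInter fun i _ => isClosed_singleton.preimage (continuous_apply i))
  convert isGc_biInter h𝒱 fun V hV => (hgo V (h𝒱o V hV).1).isGc using 1
  refine Set.Subset.antisymm ?_ fun x hx => ?_
  · rintro _ rfl
    exact Set.mem_iInter₂.2 fun V hV => ⟨fun _ => p, (h𝒱o V hV).2 (by simp), hgp⟩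
  · by_contra hxq
    obtain ⟨V, hV, hVx⟩ := h𝒱base (g ⁻¹' {x}ᶜ) (isOpen_compl_singleton.preimage hgc) (by
      intro z hz
      rw [Set.mem_preimage, hconst z (by simpa using hz)]
      exact fun h => hxq h.symm)
    obtain ⟨z, hz, hzx⟩ := Set.mem_iInter₂.1 hx V hV
    exact hVx hz hzx

end PowerHomogeneous

/-! ### Covers by `G_δ`-sets -/

section Lindelof

variable {X : Type u} [TopologicalSpace X]

theorem IsGc.hasPiCharacterLeContinuum [CompactSpace X] [T2Space X] {x : X} (hx : IsGc {x}) :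
    HasPiCharacterLeContinuum x := by
  obtain ⟨𝒪, h𝒪, h𝒪o, h𝒪base⟩ := hx.exists_outer_base isClosed_singleton
  exact ⟨𝒪, h𝒪, fun O hO => ⟨(h𝒪o O hO).1, x, (h𝒪o O hO).2 rfl⟩,
    fun U hU hxU => h𝒪base U hU (by simpa using hxU)⟩

theorem exists_isGδ_mem_subset_of_isOpen {U : Set (GDeltaModification X)} (hU : IsOpen U) {x : X}
    (hx : x ∈ U) : ∃ G : Set X, IsGδ G ∧ x ∈ G ∧ G ⊆ U := by
  induction hU with
  | basic s hs => exact ⟨s, hs, hx, subset_rfl⟩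
  | univ => exact ⟨Set.univ, IsGδ.univ, trivial, fun _ _ => trivial⟩
  | inter s t _ _ ihs iht =>
    obtain ⟨G, hG, hxG, hGs⟩ := ihs hx.1
    obtain ⟨G', hG', hxG', hGt⟩ := iht hx.2
    exact ⟨G ∩ G', hG.inter hG', ⟨hxG, hxG'⟩, Set.inter_subset_inter hGs hGt⟩
  | sUnion S _ ih =>
    obtain ⟨s, hs, hxs⟩ := hx
    obtain ⟨G, hG, hxG, hGs⟩ := ih s hs hxs
    exact ⟨G, hG, hxG, hGs.trans (Set.subset_sUnion_of_mem hs)⟩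

/-- The closure of a countable set `B` has a network of size at most `𝔠`, namely the closures of
the subsets of `B`; hence covers of it by `G_δ`-sets have subcovers of size at most `𝔠`. -/
theorem exists_subcover_closure_of_countable [RegularSpace X] {B : Set X} (hB : B.Countable)
    {O : X → ℕ → Set X} (hO : ∀ z k, IsOpen (O z k)) (hmem : ∀ z k, z ∈ O z k) :
    ∃ V : Set X, #V ≤ 𝔠 ∧ ∀ y ∈ closure B, ∃ z ∈ V, ∀ k, y ∈ O z k := by
  rcases isEmpty_or_nonempty X with hX | hX
  · exact ⟨∅, by simp, fun y => isEmptyElim y⟩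
  have hcard : #(ℕ → 𝒫 B) ≤ 𝔠 := by
    have h1 : #(𝒫 B) ≤ 𝔠 := (mk_le_mk_of_subset (t := {t : Set X | t ⊆ B ∧ t.Countable})
      fun t ht => ⟨ht, hB.mono ht⟩).trans (mk_countable_subsets_le_continuum hB.mk_le_continuum)
    rw [mk_pi, prod_const, mk_nat, lift_aleph0, lift_uzero, ← continuum_power_aleph0]
    exact power_le_power_right h1
  have h : ∀ E : ℕ → 𝒫 B, ∃ z, (∃ y, ∀ k, closure (E k : Set X) ⊆ O y k) →
      ∀ k, closure (E k : Set X) ⊆ O z k := fun E => by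
    by_cases hE : ∃ y, ∀ k, closure (E k : Set X) ⊆ O y k
    · exact ⟨hE.choose, fun _ => hE.choose_spec⟩
    · exact ⟨Classical.arbitrary X, fun h => absurd h hE⟩
  choose z hz using h
  refine ⟨Set.range z, mk_range_le_continuum hcard z, fun y hy => ?_⟩
  choose E hEB hyE hEO using fun k =>
    exists_subset_mem_closure_subset hy ((hO y k).mem_nhds (hmem y k))
  exact ⟨_, ⟨fun k => ⟨E k, hEB k⟩, rfl⟩,
    fun k => hz (fun k => ⟨E k, hEB k⟩) ⟨y, hEO⟩ k (hyE k)⟩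

/-- A set `A` of size at most `𝔠` is closed off so that `A ∩ C n` is dense in `A` for all `n`,
which makes every point of `closure A` lie in the closure of a countable subset of `A`. Then at most
`𝔠` members of the cover cover `closure A`, and by compactness of `closure A` they cover `X`, as `A`
meets the complement of any finite union of the open sets involved that is not all of `X`. -/
theorem lindelofNumber_gDeltaModification_le [CompactSpace X] [T2Space X] {C : ℕ → Set X}
    (hcov : ⋃ n, C n = Set.univ) (hC : ∀ n, CountablyTightIn (C n))
    (hdense : ∀ x n, ∃ A ⊆ C n, #A ≤ 𝔠 ∧ x ∈ closure A) :
    lindelofNumber (GDeltaModification X) ≤ 𝔠 := by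
  refine csInf_le' ⟨aleph0_le_continuum, fun 𝒰 h𝒰 h𝒰cov => ?_⟩
  rcases isEmpty_or_nonempty X with hX | hX
  · exact ⟨∅, Set.empty_subset _, by simp, Set.eq_univ_of_forall fun x => isEmptyElim (α := X) x⟩
  have hO : ∀ x : X, ∃ U ∈ 𝒰, ∃ O : ℕ → Set X, (∀ k, IsOpen (O k)) ∧ (∀ k, x ∈ O k) ∧
      ⋂ k, O k ⊆ U := fun x => by
    obtain ⟨U, hU, hxU⟩ := Set.mem_sUnion.1 (h𝒰cov ▸ Set.mem_univ x : x ∈ ⋃₀ 𝒰)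
    obtain ⟨G, hG, hxG, hGU⟩ := exists_isGδ_mem_subset_of_isOpen (h𝒰 U hU) hxU
    obtain ⟨O, hO, rfl⟩ := isGδ_iff_eq_iInter_nat.1 hG
    exact ⟨U, hU, O, hO, Set.mem_iInter.1 hxG, hGU⟩
  choose U hU O hOo hxO hOU using hO
  have hV := fun (B : Set X) (hB : B.Countable) => exists_subcover_closure_of_countable hB hOo hxO
  choose! V hV hVcov using hV
  choose D hDC hD hxD using hdense
  have hpt : ∀ M : Set X, ∃ x, M ≠ Set.univ → x ∉ M := fun M => by
    by_cases hM : M = Set.univ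
    · exact ⟨Classical.arbitrary X, fun h => absurd hM h⟩
    · obtain ⟨x, hx⟩ := (Set.ne_univ_iff_exists_notMem M).1 hM
      exact ⟨x, fun _ => hx⟩
  choose pt hpt using hpt
  have hinl : ∀ S : Set (X ⊕ Set X), S.Countable → (Sum.inl ⁻¹' S : Set X).Countable :=
    fun S hS => hS.preimage_of_injOn Sum.inl_injective.injOn
  -- Points and open sets are closed off simultaneously.
  obtain ⟨T, hT, hTΦ⟩ := exists_closed_of_countable_operation
    (Φ := fun S : Set (X ⊕ Set X) =>
      Sum.inr '' (⋃ z ∈ V (Sum.inl ⁻¹' S), Set.range (O z)) ∪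
        (Sum.inl '' (⋃ x ∈ (Sum.inl ⁻¹' S : Set X), ⋃ n, D x n) ∪
          {Sum.inl (pt (⋃₀ (Sum.inr ⁻¹' S)))})) fun S hS =>
      mk_union_le_continuum
        (mk_image_le_continuum (mk_biUnion_le_continuum (hV _ (hinl S hS)) fun z _ =>
          (Set.countable_range _).mk_le_continuum) _) <|
        mk_union_le_continuum
          (mk_image_le_continuum (mk_biUnion_le_continuum (hinl S hS).mk_le_continuum fun x _ =>
            mk_iUnion_le_continuum (mk_nat.trans_le aleph0_le_continuum) (hD x)) _)
          (Set.countable_singleton _).mk_le_continuum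
  let A : Set X := Sum.inl ⁻¹' T
  have hA : #A ≤ 𝔠 := (mk_preimage_of_injective _ _ Sum.inl_injective).trans hT
  have hAclosure : ∀ y ∈ closure A, ∃ B ⊆ A, B.Countable ∧ y ∈ closure B := fun y hy => by
    obtain ⟨n, hyn⟩ := Set.mem_iUnion.1 (hcov ▸ Set.mem_univ y)
    have hsub : A ⊆ closure (A ∩ C n) := fun a ha => by
      refine closure_mono (Set.subset_inter (fun d hd => ?_) (hDC a n)) (hxD a n)
      refine hTΦ {Sum.inl a} (Set.singleton_subset_iff.2 ha) (Set.countable_singleton _)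
        (.inr (.inl ⟨d, ?_, rfl⟩))
      exact Set.mem_biUnion (x := a) rfl (Set.mem_iUnion.2 ⟨n, hd⟩)
    obtain ⟨B, hBA, hB, hyB⟩ := hC n (A ∩ C n) Set.inter_subset_right y hyn
      (closure_minimal hsub isClosed_closure hy)
    exact ⟨B, hBA.trans Set.inter_subset_left, hB, hyB⟩
  refine ⟨U '' ⋃ B ∈ {B : Set X | B ⊆ A ∧ B.Countable}, V B, ?_, ?_,
    Set.eq_univ_of_forall fun x => ?_⟩
  · rintro _ ⟨z, -, rfl⟩
    exact hU z
  · exact mk_image_le_continuum (mk_biUnion_le_continuum (mk_countable_subsets_le_continuum hA)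
      fun B hB => hV B hB.2) _
  by_contra hx
  obtain ⟨𝒩, h𝒩, h𝒩fin, h𝒩cov⟩ := (isClosed_closure (s := A)).isCompact.elim_finite_subcover_image
    (b := {M : Set X | Sum.inr M ∈ T ∧ IsOpen M ∧ x ∉ M}) (c := id) (fun M hM => hM.2.1) (by
      intro y hy
      obtain ⟨B, hBA, hB, hyB⟩ := hAclosure y hy
      obtain ⟨z, hz, hyz⟩ := hVcov B hB y hyB
      obtain ⟨k, hk⟩ : ∃ k, x ∉ O z k := by
        by_contra! hxz
        exact hx ⟨U z, ⟨z, Set.mem_biUnion (x := B) ⟨hBA, hB⟩ hz, rfl⟩,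
          hOU z (Set.mem_iInter.2 hxz)⟩
      refine Set.mem_biUnion (x := O z k) ⟨?_, hOo z k, hk⟩ (hyz k)
      refine hTΦ (Sum.inl '' B) (by simpa using hBA) (hB.image _) (.inl ⟨O z k, ?_, rfl⟩)
      rw [Set.preimage_image_eq B Sum.inl_injective]
      exact Set.mem_biUnion hz ⟨k, rfl⟩)
  have hptA : pt (⋃₀ 𝒩) ∈ A := by
    refine hTΦ (Sum.inr '' 𝒩) (by rintro _ ⟨M, hM, rfl⟩; exact (h𝒩 hM).1)
      (h𝒩fin.countable.image _) (.inr (.inr ?_))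
    rw [Set.preimage_image_eq 𝒩 Sum.inr_injective]
    rfl
  refine hpt (⋃₀ 𝒩) (fun h => ?_) ?_
  · obtain ⟨M, hM, hxM⟩ := Set.mem_sUnion.1 (h ▸ Set.mem_univ x : x ∈ ⋃₀ 𝒩)
    exact (h𝒩 hM).2.2 hxM
  · obtain ⟨M, hM, hptM⟩ := Set.mem_iUnion₂.1 (h𝒩cov (subset_closure hptA))
    exact ⟨M, hM, hptM⟩

end Lindelof

theorem mainTheorem4 (X : Type u) [TopologicalSpace X] [CompactSpace X] [T2Space X]
    (hX : IsPowerHomogeneous.{u, v} X)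
    (hcov : ∃ 𝒞 : Set (Set X), 𝒞.Countable ∧ ⋃₀ 𝒞 = Set.univ ∧
      ∀ C ∈ 𝒞, Dense C ∧ IsCountablyTight C) :
    lindelofNumber (GDeltaModification X) ≤ 𝔠 := by
  obtain ⟨𝒞, h𝒞, h𝒞cov, h𝒞C⟩ := hcov
  rcases 𝒞.eq_empty_or_nonempty with rfl | hne
  · have : IsEmpty X := Set.univ_eq_empty_iff.1 (by rw [← h𝒞cov, Set.sUnion_empty])
    exact lindelofNumber_gDeltaModification_le (C := fun _ => ∅) (Subsingleton.elim _ _)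
      (fun _ _ _ x => isEmptyElim x) fun x => isEmptyElim x
  · obtain ⟨C, rfl⟩ := h𝒞.exists_eq_range hne
    rw [Set.sUnion_range] at h𝒞cov
    have hC : ∀ n, CountablyTightIn (C n) := fun n => (h𝒞C _ ⟨n, rfl⟩).2.countablyTightIn
    have hd : ∀ n, Dense (C n) := fun n => (h𝒞C _ ⟨n, rfl⟩).1
    exact lindelofNumber_gDeltaModification_le h𝒞cov hC fun x n =>
      (hX.isGc_singleton (dense_setOf_isGc_singleton h𝒞cov hC hd)
        x).hasPiCharacterLeContinuum.exists_subset_mem_closure (hd n)
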